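/- Let $q$ be a prime power. For integers $r, R\ge 1$ let the length function $\ell_q(r,R)$ be the smallest length $n$ of an $\mathbb F_q$-linear code $C\subseteq\mathbb F_q^{\,n}$ of codimension $r$ and covering radius $R$, where the covering radius is the least integer $\varrho\ge 0$ such that the Hamming spheres of radius $\varrho$ centred at the codewords cover $\mathbb F_q^{\,n}$. A set $S$ of points of the projective space $\mathrm{PG}(N,q)$ is $\rho$-saturating if every point of $\mathrm{PG}(N,q)$ is (in homogeneous coordinates) a linear combination of at most $\rho+1$ points of $S$, and $\rho\ge 0$ is the smallest integer with this property; let $s_q(N,\rho)$ be the smallest size of a $\rho$-saturating set in $\mathrm{PG}(N,q)$. Let $R\ge 4$ and $t\ge 2$ be integers, put $r=tR$ and $m_1=\lceil\log_q(R+1)\rceil+1$. Then $\ell_q(r,R)=s_q(r-1,R-1)$, and $$\ell_q(r,R)=s_q(r-1,R-1)\le Rq^{(r-R)/R}+q^{(r-2R)/R}+\Delta_q(r,R)$$ holds (in particular such codes and saturating sets exist) in each of the following cases, with the stated value of $\Delta_q(r,R)$; note that $(r-jR)/R=t-j$. (i) $\Delta_q(r,R)=0$ if $t=2$ and $q=4$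 or $q\ge 7$. (ii) $\Delta_q(r,R)=0$ if $t=2$, $q=5$ and $R\in\{4,5\}$. (iii) $\Delta_q(r,R)=0$ if $t\ge\lceil\log_q R\rceil+3$ and $q\ge 7$ is odd. (iv) $\Delta_q(r,R)=\sum_{j=2}^{t}q^{(r-jR)/R}$ if $m_1+2<t<3m_1+2$ and $q\ge 8$ is even. (v) $\Delta_q(r,R)=\sum_{j=2}^{m_1+2}q^{(r-jR)/R}$ if $t=m_1+2$ or $t\ge 3m_1+2$, and $q\ge 8$ is even. -/

import Mathlib

open scoped LinearAlgebra.Projectivization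

/-- Every vector of `K ^ n` lies in a Hamming sphere of radius `ρ` centred at a codeword of the
linear code `C`. -/
def CoversWithRadius {K : Type*} [Field K] [DecidableEq K] {n : ℕ}
    (C : Submodule K (Fin n → K)) (ρ : ℕ) : Prop :=
  ∀ v : Fin n → K, ∃ c ∈ C, hammingDist v c ≤ ρ

/-- `C` is an `[n, n - r]` code over `K` (codimension `r`) whose covering radius is exactly `R`,
that is, `R` is the least radius for which the spheres centred at the codewords cover `K ^ n`. -/
def IsCoveringCode {K : Type*} [Field K] [DecidableEq K] {n : ℕ}
    (C : Submodule K (Fin n → K)) (r R : ℕ) : Prop :=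
  Module.finrank K C + r = n ∧ IsLeast {ρ : ℕ | CoversWithRadius C ρ} R

/-- The length function: the smallest length of a linear code over `K` of codimension `r` and
covering radius `R`. It takes values in `ℕ∞` and is `⊤` if there is no such code, so that any
finite upper bound includes the existence of a code. -/
noncomputable def lengthFunction (K : Type*) [Field K] [DecidableEq K] (r R : ℕ) : ℕ∞ :=
  ⨅ (n : ℕ) (_ : ∃ C : Submodule K (Fin n → K), IsCoveringCode C r R), (n : ℕ∞)

/-- The projective space `PG(N, K)` of dimension `N` over `K`. -/
abbrev PG (N : ℕ) (K : Type*) [Field K] : Type _ := ℙ K (Fin (N + 1) → K)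

/-- Every point of `PG(N, K)` is a linear combination of at most `ρ + 1` points of `S`. -/
def SaturatesWith {K : Type*} [Field K] {N : ℕ} (S : Finset (PG N K)) (ρ : ℕ) : Prop :=
  ∀ A : PG N K, ∃ T : Finset (PG N K), T ⊆ S ∧ T.card ≤ ρ + 1 ∧
    A.submodule ≤ ⨆ P ∈ T, P.submodule

/-- `S` is a `ρ`-saturating set: every point is a linear combination of at most `ρ + 1` points
of `S`, and `ρ` is the smallest value with this property. -/
def IsSaturating {K : Type*} [Field K] {N : ℕ} (S : Finset (PG N K)) (ρ : ℕ) : Prop :=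
  IsLeast {ρ' : ℕ | SaturatesWith S ρ'} ρ

/-- The smallest size of a `ρ`-saturating set in `PG(N, K)` (`⊤` if there is none). -/
noncomputable def smallestSaturatingSize (K : Type*) [Field K] (N ρ : ℕ) : ℕ∞ :=
  ⨅ (S : Finset (PG N K)) (_ : IsSaturating S ρ), (S.card : ℕ∞)

/-- `m₁ = ⌈log_q (R + 1)⌉ + 1`. -/
noncomputable def mOne (q R : ℕ) : ℕ := ⌈Real.logb (q : ℝ) ((R : ℝ) + 1)⌉₊ + 1

/-- The bound `R q^((r-R)/R) + q^((r-2R)/R) + Δ` for `r = t R`; here `(r - j R) / R = t - j`.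
It is used for `t ≥ 2` only. -/
def lengthBound (q t R Δ : ℕ) : ℕ := R * q ^ (t - 1) + q ^ (t - 2) + Δ

/-!
Reading the columns of a parity check matrix as vectors, or as points of a projective space, turns
both quantities into one: the least size of a family in an `r`-dimensional space in which every
vector is a combination of at most `R` members, with `R` least possible.

For `t = 2`, start with the points of a projective line and distinguish one of them, `P`. Then
repeatedly attach a plane that meets the old space in `P` only, and replace `P` by the graph of a
function in that plane together with one point at infinity, which becomes the new `P`. Each step
adds `q` vectors, two dimensions and one to the radius, so that `R q + 1` vectors suffice in
dimension `2 R`. The graph needs enough secants: the function is the indicator of a set of three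
points with no affine symmetry for `q ≥ 8`, the square for `q = 4`, and an explicit polynomial for
`q = 5, 7`.

For `t ≥ 3`, the point is that, for `q ≥ 5` and `R ≥ 3`, every vector is a combination of *exactly*
`R` members of this family. Attach to the members distinct points of the rational normal curve over
the field `E` of `q ^ (t - 2)` elements, and extend each member by all `E`-multiples of its point:
since any `R` points of the curve are linearly independent, the new coordinates can be prescribed
at will.

That the radius equals `R` is no restriction: subtracting multiples of basis vectors from the other
members, one at a time, changes the radius by at most one per step and ends at radius at least
`r ≥ R`, so that it takes the value `R` on the way.
-/

section SparseComb

variable (K : Type*) [Field K] {ι κ V W : Type*}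
  [AddCommGroup V] [Module K V] [AddCommGroup W] [Module K W]

/-- `v` is a linear combination, with nonzero coefficients, of `k - d` members of the family `g`
for some `d ∈ D`. With `D = ⊥` exactly `k` members are used, with `D = ⊤` at most `k`; a
construction that works for every `D` treats both cases at once. -/
def SparseComb (D : AddSubmonoid ℕ) (g : ι → V) (k : ℕ) (v : V) : Prop :=
  ∃ c : ι →₀ K, Finsupp.linearCombination K g c = v ∧ ∃ d ∈ D, c.support.card + d = k

variable {K} {D : AddSubmonoid ℕ} {g : ι → V} {k l : ℕ} {v : V}

lemma sparseComb_zero (D : AddSubmonoid ℕ) (g : ι → V) : SparseComb K D g 0 0 :=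
  ⟨0, by simp, 0, D.zero_mem, by simp⟩

lemma SparseComb.smul (h : SparseComb K D g k v) {a : K} (ha : a ≠ 0) :
    SparseComb K D g k (a • v) := by
  obtain ⟨c, rfl, d, hd, hk⟩ := h
  exact ⟨a • c, by simp, d, hd, by rwa [Finsupp.support_smul_eq ha]⟩

lemma SparseComb.map (h : SparseComb K D g k v) (A : V →ₗ[K] W) :
    SparseComb K D (A ∘ g) k (A v) := by
  obtain ⟨c, rfl, hk⟩ := h
  exact ⟨c, (Finsupp.apply_linearCombination K A g c).symm, hk⟩

lemma SparseComb.of_comp {x : κ → ι} (h : SparseComb K D (g ∘ x) k v)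
    (hx : Function.Injective x) : SparseComb K D g k v := by
  obtain ⟨c, rfl, hk⟩ := h
  refine ⟨c.embDomain ⟨x, hx⟩, Finsupp.linearCombination_embDomain K _ _, ?_⟩
  simpa only [Finsupp.support_embDomain, Finset.card_map] using hk

lemma SparseComb.sumElim {φ : κ → V} {w : V} (hv : SparseComb K D g k v)
    (hw : SparseComb K D φ l w) : SparseComb K D (Sum.elim g φ) (k + l) (v + w) := by
  obtain ⟨c, rfl, d, hd, rfl⟩ := hv
  obtain ⟨c', rfl, d', hd', rfl⟩ := hw
  refine ⟨c.sumElim c', ?_, d + d', D.add_mem hd hd', ?_⟩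
  · rw [Finsupp.sumElim_eq_add, map_add, Finsupp.linearCombination_mapDomain,
      Finsupp.linearCombination_mapDomain, Sum.elim_comp_inl, Sum.elim_comp_inr]
  · rw [Finsupp.sumElim_support, Finset.card_disjSum]
    omega

lemma sparseComb_of_injective (D : AddSubmonoid ℕ) (g : ι → V) {n : ℕ} {x : Fin n → ι}
    (hx : Function.Injective x) {a : Fin n → K} (ha : ∀ j, a j ≠ 0) :
    SparseComb K D g n (∑ j, a j • g (x j)) := by
  refine SparseComb.of_comp (x := x) ⟨Finsupp.equivFunOnFinite.symm a, ?_, 0, D.zero_mem, ?_⟩ hx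
  · exact Finsupp.linearCombination_eq_fintype_linearCombination_apply K _ a
  · have : (Finsupp.equivFunOnFinite.symm a).support = Finset.univ := by ext j; simp [ha j]
    simp [this]

lemma SparseComb.mono {l : ℕ} (h : SparseComb K ⊤ g k v) (hkl : k ≤ l) : SparseComb K ⊤ g l v := by
  obtain ⟨c, hc, d, -, rfl⟩ := h
  exact ⟨c, hc, l - c.support.card, trivial, by omega⟩

lemma SparseComb.to_top (h : SparseComb K D g k v) : SparseComb K ⊤ g k v := by
  obtain ⟨c, hc, d, -, hk⟩ := h
  exact ⟨c, hc, d, trivial, hk⟩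

lemma sparseComb_top_iff :
    SparseComb K ⊤ g k v ↔
      ∃ c : ι →₀ K, Finsupp.linearCombination K g c = v ∧ c.support.card ≤ k := by
  simp [SparseComb, le_iff_exists_add, eq_comm]

lemma sparseComb_top_iff_hammingNorm [Fintype ι] [DecidableEq K] :
    SparseComb K ⊤ g k v ↔
      ∃ x : ι → K, Fintype.linearCombination K g x = v ∧ hammingNorm x ≤ k := by
  rw [sparseComb_top_iff, Finsupp.equivFunOnFinite.exists_congr_left]
  refine exists_congr fun c => ?_
  have hsupport : (Finsupp.equivFunOnFinite.symm c).support =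
      Finset.univ.filter fun i => c i ≠ 0 := by ext i; simp
  rw [hsupport, hammingNorm]
  exact and_congr_left' (Eq.congr_left
    (Finsupp.linearCombination_eq_fintype_linearCombination_apply K g c))

lemma sparseComb_top_iff_mem_span :
    SparseComb K ⊤ g k v ↔ ∃ T : Finset ι, T.card ≤ k ∧ v ∈ Submodule.span K (g '' T) := by
  rw [sparseComb_top_iff]
  constructor
  · rintro ⟨c, rfl, hc⟩
    exact ⟨c.support, hc,
      (Finsupp.mem_span_image_iff_linearCombination K).2 ⟨c, Set.Subset.rfl, rfl⟩⟩
  · rintro ⟨T, hT, hv⟩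
    obtain ⟨c, hc, rfl⟩ := (Finsupp.mem_span_image_iff_linearCombination K).1 hv
    exact ⟨c, rfl, (Finset.card_le_card (Finset.coe_subset.1 hc)).trans hT⟩

/-- The family `g` extended by the vector `P`. -/
def extendBy (P : V) (g : ι → V) : Option ι → V := fun i => i.elim P g

lemma card_support_some_of_eq_zero {c : Option ι →₀ K} (h : c none = 0) :
    c.some.support.card = c.support.card := by
  rw [← Finset.card_eraseNone_of_not_mem (s := c.support) (by simpa using h)]
  congr 1
  ext i
  simp

lemma card_support_some_add_one {c : Option ι →₀ K} (h : c none ≠ 0) :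
    c.some.support.card + 1 = c.support.card := by
  have hmem : none ∈ c.support := Finsupp.mem_support_iff.2 h
  have hsome : c.some.support = c.support.eraseNone := by ext i; simp
  rw [hsome, Finset.card_eraseNone_of_mem hmem, Nat.sub_add_cancel (Finset.card_pos.2 ⟨_, hmem⟩)]

lemma linearCombination_extendBy (P : V) (g : ι → V) (c : Option ι →₀ K) :
    Finsupp.linearCombination K (extendBy P g) c =
      c none • P + Finsupp.linearCombination K g c.some :=
  Finsupp.linearCombination_option K (extendBy P g) c

lemma sparseComb_extendBy_iff {P : V} :
    SparseComb K D (extendBy P g) k v ↔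
      SparseComb K D g k v ∨ ∃ μ : K, μ ≠ 0 ∧ ∃ l, l + 1 = k ∧ SparseComb K D g l (v - μ • P) := by
  constructor
  · rintro ⟨c, rfl, d, hd, rfl⟩
    by_cases hc : c none = 0
    · exact .inl ⟨c.some, by simp [linearCombination_extendBy, hc], d, hd,
        by rw [card_support_some_of_eq_zero hc]⟩
    · refine .inr ⟨c none, hc, c.some.support.card + d, ?_, c.some, ?_, d, hd, rfl⟩
      · rw [← card_support_some_add_one hc]
        omega
      · rw [linearCombination_extendBy, add_sub_cancel_left]
  · rintro (h | ⟨μ, hμ, l, rfl, c, hc, d, hd, rfl⟩)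
    · exact SparseComb.of_comp (x := some) h (Option.some_injective ι)
    · refine ⟨c.optionElim μ, ?_, d, hd, ?_⟩
      · simp [linearCombination_extendBy, hc]
      · rw [← card_support_some_add_one (by simpa using hμ), Finsupp.some_optionElim]
        omega

end SparseComb

section Gluing

variable {K : Type*} [Field K] {D : AddSubmonoid ℕ} {ι κ V : Type*} [AddCommGroup V] [Module K V]
  {g : ι → V} {P : V} {f : K → K} {R : ℕ}

variable (K) in
/-- Every vector is a combination of the members of `g` of size `k` in the sense of `SparseComb`.
The zero vector is excused for `k ≤ 2`, as it is never a combination of one or two members of a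
family of pairwise independent vectors. -/
def SparselySpans (D : AddSubmonoid ℕ) (g : ι → V) (k : ℕ) : Prop :=
  ∀ v, (v = 0 → 3 ≤ k) → SparseComb K D g k v

variable (K) in
/-- The induction hypothesis of the gluing construction: the family `g` covers the space with
combinations of size `R` once the vector `P` is added to it, and with combinations of size `R + 1`,
`R + 2` and `R + 3` on its own. -/
structure IsGlueable (D : AddSubmonoid ℕ) (g : ι → V) (P : V) (R : ℕ) : Prop where
  ne_zero : P ≠ 0
  spans : SparselySpans K D (extendBy P g) R
  spans_add : ∀ j, 1 ≤ j → j ≤ 3 → SparselySpans K D g (R + j)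

/-- The point of the graph of `f` above `y`, in homogeneous coordinates. -/
def graphPoint (f : K → K) (y : K) : K × K × K := (f y, 1, y)

variable (D) in
/-- The conditions on the combinations of points of the graph of `f` under which the graph can be
glued to a family covering a space. The point to be replaced is `(1, 0, 0)`, and `(0, 0, 1)` is the
point at infinity that takes over its role. -/
structure IsGluingCurve (f : K → K) : Prop where
  affine : ∀ y l, SparseComb K D (extendBy (0, 0, 1) (graphPoint f)) 2 (l, 1, y)
  slope : ∀ l, l ≠ 0 → SparseComb K D (graphPoint f) 2 (l, 0, 1)
  infinity : SparseComb K D (extendBy (0, 0, 1) (graphPoint f)) 2 (0, 0, 1)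
  slope_three : ∀ l, SparseComb K D (graphPoint f) 3 (l, 0, 1)
  point : SparseComb K D (graphPoint f) 3 (1, 0, 0)
  graph : ∀ y, SparseComb K D (graphPoint f) 3 (f y, 1, y)

/-- The embedding of a plane in `V × K × K` that sends `(1, 0, 0)` to `P`. -/
def planeEmbedding (P : V) : K × K × K →ₗ[K] V × K × K :=
  (LinearMap.toSpanSingleton K V P).prodMap LinearMap.id

/-- The family `g` in `V` and the family `φ` in a plane, placed in a space where the plane meets
`V` in the point `P`. -/
def glueFamily (g : ι → V) (P : V) (φ : κ → K × K × K) : ι ⊕ κ → V × K × K :=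
  Sum.elim (LinearMap.inl K V (K × K) ∘ g) (planeEmbedding P ∘ φ)

lemma SparseComb.glue {φ : κ → K × K × K} {k l n : ℕ} {v w : V} {a b c : K}
    (hv : SparseComb K D g k v) (hφ : SparseComb K D φ l (a, b, c)) (hn : k + l = n)
    (hw : v + a • P = w) : SparseComb K D (glueFamily g P φ) n (w, b, c) := by
  subst hn hw
  simpa [glueFamily, planeEmbedding] using!
    (hv.map (LinearMap.inl K V (K × K))).sumElim (hφ.map (planeEmbedding P))

lemma SparseComb.extend {k : ℕ} {v : V} (h : SparseComb K D g k v) (P : V) :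
    SparseComb K D (extendBy P g) k v :=
  sparseComb_extendBy_iff.2 (.inl h)

lemma SparseComb.glue_extend {φ : κ → K × K × K} {k l n : ℕ} {v w : V} {a b c : K}
    (hv : SparseComb K D g k v) (hφ : SparseComb K D (extendBy (0, 0, 1) φ) l (a, b, c))
    (hn : k + l = n) (hw : v + a • P = w) :
    SparseComb K D (extendBy (0, 0, 1) (glueFamily g P φ)) n (w, b, c) := by
  rcases sparseComb_extendBy_iff.1 hφ with h | ⟨μ, hμ, m, rfl, h⟩
  · exact (hv.glue h hn hw).extend _
  · refine sparseComb_extendBy_iff.2 (.inr ⟨μ, hμ, k + m, by omega, ?_⟩)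
    have h' : SparseComb K D φ m (a, b, c - μ) := by simpa using h
    simpa using hv.glue h' rfl hw

lemma sparseComb_one (D : AddSubmonoid ℕ) (g : ι → V) (i : ι) {a : K} (ha : a ≠ 0) :
    SparseComb K D g 1 (a • g i) := by
  simpa using sparseComb_of_injective D g (x := ![i]) (Function.injective_of_subsingleton _)
    (a := ![a]) (by simpa using ha)

lemma forall_prod_of_smul {p : V × K × K → Prop} (smul : ∀ x, p x → ∀ a : K, a ≠ 0 → p (a • x))
    (affine : ∀ v y, p (v, 1, y)) (infinity : ∀ v, p (v, 0, 1)) (base : ∀ v, p (v, 0, 0)) (x) :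
    p x := by
  obtain ⟨v, a, y⟩ := x
  rcases eq_or_ne a 0 with rfl | ha
  · rcases eq_or_ne y 0 with rfl | hy
    · exact base v
    · simpa [hy] using smul _ (infinity (y⁻¹ • v)) y hy
  · simpa [ha] using smul _ (affine (a⁻¹ • v) (a⁻¹ * y)) a ha

lemma sparselySpans_of_normalized {k : ℕ} {γ : κ → V × K × K}
    (affine : ∀ v y, SparseComb K D γ k (v, 1, y)) (infinity : ∀ v, SparseComb K D γ k (v, 0, 1))
    (base : ∀ v, (v = 0 → 3 ≤ k) → SparseComb K D γ k (v, 0, 0)) : SparselySpans K D γ k :=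
  forall_prod_of_smul
    (fun x hx a ha h => (hx fun h0 => h (by simp [h0])).smul ha)
    (fun v y _ => affine v y) (fun v _ => infinity v)
    (fun v h => base v fun h0 => h (by simp [h0]))

lemma sparseComb_graphPoint (D : AddSubmonoid ℕ) (f : K → K) (y : K) :
    SparseComb K D (graphPoint f) 1 (f y, 1, y) := by
  simpa [graphPoint] using sparseComb_one D (graphPoint f) y (one_ne_zero (α := K))

lemma exists_forall_ne_of_card_lt {α : Type*} [Fintype α] {n : ℕ} (hα : n < Fintype.card α)
    (x : Fin n → α) : ∃ y, ∀ i, y ≠ x i := by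
  by_contra! h
  exact hα.not_ge (by simpa using Fintype.card_le_of_surjective x fun y => (h y).imp fun _ => .symm)

lemma exists_sub_smul_ne_zero [Fintype K] (hK : 3 ≤ Fintype.card K) (hP : P ≠ 0) (v : V) :
    ∃ μ : K, μ ≠ 0 ∧ v - μ • P ≠ 0 := by
  by_cases h : v - (1 : K) • P = 0
  · obtain ⟨μ, hμ⟩ := exists_forall_ne_of_card_lt hK ![0, 1]
    refine ⟨μ, hμ 0, fun h' => hμ 1 (smul_left_injective K hP ?_)⟩
    exact (sub_eq_zero.1 h').symm.trans (sub_eq_zero.1 h)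
  · exact ⟨1, one_ne_zero, h⟩

namespace IsGlueable

variable (hg : IsGlueable K D g P R) (hf : IsGluingCurve D f)
include hg hf

lemma spans_glue (hR : 1 ≤ R) :
    SparselySpans K D (extendBy (0, 0, 1) (glueFamily g P (graphPoint f))) (R + 1) := by
  have zero_comb : SparseComb K D g 0 0 := sparseComb_zero D g
  refine sparselySpans_of_normalized (fun v y => ?_) (fun v => ?_) fun v hv => ?_
  · obtain ⟨u, rfl⟩ : ∃ u, u + f y • P = v := ⟨v - f y • P, by abel⟩
    by_cases hu : u = 0 → 3 ≤ R
    · rcases sparseComb_extendBy_iff.1 (hg.spans _ hu) with h | ⟨μ, -, l, rfl, h⟩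
      · exact (h.glue (sparseComb_graphPoint D f y) rfl rfl).extend _
      · exact h.glue_extend (hf.affine y (μ + f y)) rfl (by module)
    · obtain ⟨rfl, hR'⟩ := Classical.not_imp.1 hu
      obtain rfl | rfl : R = 1 ∨ R = 2 := by omega
      · exact zero_comb.glue_extend (hf.affine y (f y)) rfl rfl
      · exact (zero_comb.glue (hf.graph y) rfl rfl).extend _
  · by_cases hu : v = 0 → 3 ≤ R
    · rcases sparseComb_extendBy_iff.1 (hg.spans _ hu) with h | ⟨μ, hμ, l, rfl, h⟩
      · have := sparseComb_one D (extendBy (0, 0, 1) (graphPoint f)) none (one_ne_zero (α := K))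
        exact h.glue_extend (by simpa [extendBy] using this) rfl (by simp)
      · exact (h.glue (hf.slope μ hμ) (by omega) (by abel)).extend _
    · obtain ⟨rfl, hR'⟩ := Classical.not_imp.1 hu
      obtain rfl | rfl : R = 1 ∨ R = 2 := by omega
      · exact zero_comb.glue_extend hf.infinity rfl (by simp)
      · exact (zero_comb.glue (hf.slope_three 0) rfl (by simp)).extend _
  · exact ((hg.spans_add 1 le_rfl (by norm_num) v hv).glue (sparseComb_zero D _) rfl
      (by simp)).extend _

lemma spans_add_glue [Fintype K] (hK : 4 ≤ Fintype.card K) (hR : 1 ≤ R) {j : ℕ} (hj : 1 ≤ j)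
    (hj' : j ≤ 3) : SparselySpans K D (glueFamily g P (graphPoint f)) (R + 1 + j) := by
  choose μ hμ hv using exists_sub_smul_ne_zero (K := K) (by omega) hg.ne_zero
  have spans_succ (i : ℕ) (hi : 1 ≤ i) (hi' : i ≤ 3) (v : V) :
      SparseComb K D g (R + i) (v - μ v • P) := hg.spans_add i hi hi' _ (absurd · (hv v))
  refine sparselySpans_of_normalized (fun v y => ?_) (fun v => ?_) fun v _ => ?_
  · obtain ⟨u, rfl⟩ : ∃ u, u + f y • P = v := ⟨v - f y • P, by abel⟩
    by_cases hu : u = 0 → 3 ≤ R + j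
    · exact (hg.spans_add j hj hj' u hu).glue (sparseComb_graphPoint D f y) (by omega) rfl
    · obtain ⟨rfl, hR'⟩ := Classical.not_imp.1 hu
      obtain ⟨rfl, rfl⟩ : R = 1 ∧ j = 1 := by omega
      exact (sparseComb_zero D g).glue (hf.graph y) rfl rfl
  · rcases hj.eq_or_lt with rfl | hj
    · rcases sparseComb_extendBy_iff.1 (hg.spans _ (absurd · (hv v))) with h | ⟨ν, -, l, rfl, h⟩
      · exact h.glue (hf.slope _ (hμ v)) rfl (by abel)
      · exact h.glue (hf.slope_three (μ v + ν)) (by omega) (by module)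
    · exact (spans_succ (j - 1) (by omega) (by omega) v).glue (hf.slope _ (hμ v)) (by omega)
        (by abel)
  · rcases hj'.eq_or_lt with rfl | hj'
    · have : SparseComb K D (graphPoint f) 3 (μ v, 0, 0) := by simpa using hf.point.smul (hμ v)
      exact (spans_succ 1 le_rfl (by omega) v).glue this rfl (by abel)
    · exact (hg.spans_add (j + 1) (by omega) (by omega) v (by omega)).glue (sparseComb_zero D _)
        (by omega) (by simp)

protected theorem glue [Fintype K] (hK : 4 ≤ Fintype.card K) (hR : 1 ≤ R) :
    IsGlueable K D (glueFamily g P (graphPoint f)) (0, 0, 1) (R + 1) where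
  ne_zero := by simp
  spans := hg.spans_glue hf hR
  spans_add j hj hj' := hg.spans_add_glue hf (by omega) hR hj hj'

end IsGlueable

end Gluing

section Line

variable {K : Type*} [Field K] {D : AddSubmonoid ℕ}

lemma SparseComb.succ_of_injective {ι κ V : Type*} [AddCommGroup V] [Module K V] {g : ι → V}
    {k : ℕ} {v : V} {x : κ → ι} (hx : Function.Injective x) {i : ι} (hi : ∀ j, x j ≠ i) {a : K}
    (ha : a ≠ 0) (h : SparseComb K D (g ∘ x) k (v - a • g i)) : SparseComb K D g (k + 1) v := by
  have h' : SparseComb K D (extendBy (g i) (g ∘ x)) (k + 1) v :=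
    sparseComb_extendBy_iff.2 (.inr ⟨a, ha, k, rfl, h⟩)
  have hg : extendBy (g i) (g ∘ x) = g ∘ fun o : Option κ => o.elim i x := by
    ext (_ | _) <;> rfl
  rw [hg] at h'
  refine h'.of_comp ?_
  rintro (_ | j) (_ | j') hjj'
  · rfl
  · exact absurd hjj'.symm (hi j')
  · exact absurd hjj' (hi j)
  · exact congr_arg some (hx hjj')

variable (K) in
/-- The affine point `y` of the projective line, in homogeneous coordinates. -/
def linePoint (y : K) : K × K := (1, y)

lemma sparseComb_linePoint_two {x : Fin 2 → K} (hx : Function.Injective x) {a b : K}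
    (h : ∀ i, b ≠ a * x i) : SparseComb K D (linePoint K ∘ x) 2 (a, b) := by
  have h01 : x 0 - x 1 ≠ 0 := sub_ne_zero.2 (hx.ne zero_ne_one)
  have hb (i) : b - a * x i ≠ 0 := sub_ne_zero.2 (h i)
  convert sparseComb_of_injective D (linePoint K ∘ x) Function.injective_id
    (a := ![(b - a * x 1) / (x 0 - x 1), -((b - a * x 0) / (x 0 - x 1))])
    (Fin.forall_fin_two.2 ⟨div_ne_zero (hb 1) h01, neg_ne_zero.2 (div_ne_zero (hb 0) h01)⟩)
  · simp [linePoint]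
    field_simp
    ring
  · simp [linePoint]
    field_simp
    ring

lemma sparseComb_linePoint_of_three_le [Fintype K] (hK : 4 ≤ Fintype.card K) {n : ℕ} (hn : 3 ≤ n)
    {x : Fin n → K} (hx : Function.Injective x) (v : K × K) :
    SparseComb K D (linePoint K ∘ x) n v := by
  induction n, hn using Nat.le_induction generalizing v with
  | base =>
    obtain ⟨a, b⟩ := v
    obtain ⟨c, hc⟩ := exists_forall_ne_of_card_lt (n := 3) hK
      ![0, (b - a * x 0) / (x 2 - x 0), (b - a * x 1) / (x 2 - x 1)]
    refine SparseComb.succ_of_injective (Fin.castSucc_injective 2) (i := Fin.last 2)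
      (fun i => (Fin.castSucc_lt_last i).ne) (a := c) (hc 0)
      (sparseComb_linePoint_two (hx.comp (Fin.castSucc_injective 2)) ?_)
    have key (i : Fin 3) (hi : 2 ≠ i) (h : c ≠ (b - a * x i) / (x 2 - x i)) :
        b - c * x 2 ≠ (a - c * 1) * x i := by
      rw [Ne, eq_div_iff (sub_ne_zero.2 (hx.ne hi))] at h
      exact fun h' => h (by linear_combination -h')
    exact Fin.forall_fin_two.2 ⟨key 0 (by decide) (hc 1), key 1 (by decide) (hc 2)⟩
  | succ n _ ih =>
    exact SparseComb.succ_of_injective (Fin.castSucc_injective n) (i := Fin.last n)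
      (fun i => (Fin.castSucc_lt_last i).ne) (one_ne_zero (α := K))
      (ih (hx.comp (Fin.castSucc_injective n)) _)

lemma exists_injective_fin_of_le_card {α : Type*} [Fintype α] {n : ℕ} (hn : n ≤ Fintype.card α) :
    ∃ x : Fin n → α, Function.Injective x := by
  obtain ⟨x⟩ := Function.Embedding.nonempty_of_card_le (α := Fin n) (by simpa using hn)
  exact ⟨x, x.injective⟩

lemma spans_linePoint : SparselySpans K D (extendBy (0, 1) (linePoint K)) 1 := by
  rintro ⟨a, b⟩ h
  rcases eq_or_ne a 0 with rfl | ha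
  · have hb : b ≠ 0 := fun hb => absurd (h (by rw [hb]; rfl)) (by norm_num)
    simpa [extendBy] using sparseComb_one D (extendBy (0, 1) (linePoint K)) none hb
  · simpa [linePoint, mul_div_cancel₀ b ha] using
      (sparseComb_one D (linePoint K) (b / a) ha).extend (0, 1)

lemma spans_linePoint_two [Fintype K] (hK : 3 ≤ Fintype.card K) :
    SparselySpans K D (linePoint K) 2 := by
  rintro ⟨a, b⟩ h
  have avoid {y : K} (hy : y ≠ b / a) : b ≠ a * y := by
    rintro rfl
    have ha : a ≠ 0 := by rintro rfl; simp at h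
    exact hy (by field_simp)
  obtain ⟨y₀, hy₀⟩ := exists_forall_ne_of_card_lt (n := 1) (by omega) ![b / a]
  obtain ⟨y₁, hy₁⟩ := exists_forall_ne_of_card_lt hK ![b / a, y₀]
  have hx : Function.Injective ![y₀, y₁] := injective_pair_iff_ne.2 (hy₁ 1).symm
  exact (sparseComb_linePoint_two hx
    (Fin.forall_fin_two.2 ⟨avoid (hy₀ 0), avoid (hy₁ 0)⟩)).of_comp hx

lemma isGlueable_linePoint [Fintype K] (hK : 4 ≤ Fintype.card K) :
    IsGlueable K D (linePoint K) (0, 1) 1 where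
  ne_zero := by simp
  spans := spans_linePoint
  spans_add j hj hj' v hv := by
    rcases hj.eq_or_lt with rfl | hj
    · exact spans_linePoint_two (by omega) v hv
    · obtain ⟨x, hx⟩ := exists_injective_fin_of_le_card (α := K) (n := 1 + j) (by omega)
      exact (sparseComb_linePoint_of_three_le hK (by omega) hx v).of_comp hx

universe u

theorem IsGluingCurve.exists_isGlueable {K : Type u} [Field K] [Fintype K]
    (hK : 4 ≤ Fintype.card K) {f : K → K} (hf : IsGluingCurve D f) {R : ℕ} (hR : 1 ≤ R) :
    ∃ (V : Type u) (_ : AddCommGroup V) (_ : Module K V) (_ : Module.Finite K V) (ι : Type u)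
      (_ : Fintype ι) (g : ι → V) (P : V), IsGlueable K D g P R ∧
        Module.finrank K V = 2 * R ∧ Fintype.card ι = R * Fintype.card K := by
  induction R, hR using Nat.le_induction with
  | base =>
    exact ⟨K × K, inferInstance, inferInstance, inferInstance, K, inferInstance, linePoint K,
      (0, 1), isGlueable_linePoint hK, by simp, by simp⟩
  | succ R hR ih =>
    obtain ⟨V, _, _, _, ι, _, g, P, hg, hV, hι⟩ := ih
    exact ⟨V × K × K, inferInstance, inferInstance, inferInstance, ι ⊕ K, inferInstance,
      glueFamily g P (graphPoint f), (0, 0, 1), hg.glue hf hK hR, by simp [hV, mul_add],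
      by simp [hι, add_mul]⟩

end Line

section SecantGraph

variable {K : Type*} [Field K] {D : AddSubmonoid ℕ} {f : K → K}

lemma SparseComb.graphPoint_of_line {κ : Type*} {k : ℕ} {x : κ → K} (hx : Function.Injective x)
    {m b l a y : K} (hf : ∀ i, f (x i) = m * x i + b) (hl : m * y + b * a = l)
    (h : SparseComb K D (linePoint K ∘ x) k (a, y)) :
    SparseComb K D (graphPoint f) k (l, a, y) := by
  let A : K × K →ₗ[K] K × K × K :=
    (b • LinearMap.fst K K K + m • LinearMap.snd K K K).prod LinearMap.id
  have hA : A ∘ linePoint K ∘ x = graphPoint f ∘ x := by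
    funext i
    simp [A, linePoint, graphPoint, hf, add_comm]
  refine SparseComb.of_comp (x := x) ?_ hx
  simpa [← hA, A, ← hl, add_comm] using h.map A

lemma injective_triple {α : Type*} {x y z : α} (hxy : x ≠ y) (hxz : x ≠ z) (hyz : y ≠ z) :
    Function.Injective ![x, y, z] :=
  Fin.cons_injective_iff.2
    ⟨by simpa [Fin.exists_fin_two] using ⟨hxz, hxy⟩, injective_pair_iff_ne.2 hyz⟩

lemma sparseComb_graphPoint_collinear [Fintype K] (hK : 4 ≤ Fintype.card K) {x y z : K}
    (hxy : x ≠ y) (hxz : x ≠ z) (hyz : y ≠ z) {m b l a c : K} (hx : f x = m * x + b)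
    (hy : f y = m * y + b) (hz : f z = m * z + b) (hl : m * c + b * a = l) :
    SparseComb K D (graphPoint f) 3 (l, a, c) := by
  have hinj := injective_triple hxy hxz hyz
  exact (sparseComb_linePoint_of_three_le hK le_rfl hinj _).graphPoint_of_line hinj
    (by simp [Fin.forall_fin_succ, hx, hy, hz]) hl

lemma sparseComb_graphPoint_secant {z w : K} (hzw : z ≠ w) {m b l a y : K} (hfz : f z = m * z + b)
    (hfw : f w = m * w + b) (hz : y ≠ a * z) (hw : y ≠ a * w) (hl : m * y + b * a = l) :
    SparseComb K D (graphPoint f) 2 (l, a, y) := by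
  have hinj : Function.Injective ![z, w] := injective_pair_iff_ne.2 hzw
  exact (sparseComb_linePoint_two hinj (Fin.forall_fin_two.2 ⟨hz, hw⟩)).graphPoint_of_line hinj
    (Fin.forall_fin_two.2 ⟨hfz, hfw⟩) hl

lemma sparseComb_graphPoint_slope {z w : K} (hzw : z ≠ w) {l : K}
    (hl : f z - f w = l * (z - w)) : SparseComb K D (graphPoint f) 2 (l, 0, 1) :=
  sparseComb_graphPoint_secant hzw (m := l) (b := f z - l * z) (by ring)
    (by linear_combination -hl) (by simp) (by simp) (by simp)

lemma sparseComb_graphPoint_noncollinear {x y z p q : K}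
    (hxyz : (f y - f x) * (z - x) ≠ (f z - f x) * (y - x))
    (hxy : q * f x - p * x ≠ q * f y - p * y) (hxz : q * f x - p * x ≠ q * f z - p * z)
    (hyz : q * f y - p * y ≠ q * f z - p * z) :
    SparseComb K D (graphPoint f) 3 (p, 0, q) := by
  have hinj : Function.Injective ![x, y, z] := by
    refine injective_triple ?_ ?_ ?_ <;> rintro rfl <;> contradiction
  obtain ⟨t, ht⟩ : ∃ t : K, t * ((f y - f x) * (z - x) - (f z - f x) * (y - x)) = 1 :=
    ⟨_, inv_mul_cancel₀ (sub_ne_zero.2 hxyz)⟩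
  have ht0 : t ≠ 0 := left_ne_zero_of_mul_eq_one ht
  -- Cramer's rule.
  convert sparseComb_of_injective D (graphPoint f) hinj
    (a := ![t * (q * f z - p * z - (q * f y - p * y)), t * (q * f x - p * x - (q * f z - p * z)),
      t * (q * f y - p * y - (q * f x - p * x))]) ?_
  · simp [Fin.sum_univ_three, graphPoint]
    linear_combination -p * ht
  · simp [Fin.sum_univ_three, graphPoint]
    ring
  · simp [Fin.sum_univ_three, graphPoint]
    linear_combination -q * ht
  · simpa [Fin.forall_fin_succ, ht0, sub_eq_zero] using ⟨hyz.symm, hxz, hxy.symm⟩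

/-- The point `(l, y)` of the affine plane lies on a line through two points of the graph of `f`
that are not above `y`. -/
abbrev OnSecant (f : K → K) (l y : K) : Prop :=
  ∃ m z w, z ≠ y ∧ w ≠ y ∧ z ≠ w ∧ f z - l = m * (z - y) ∧ f w - l = m * (w - y)

/-- A sufficient condition for `IsGluingCurve` in terms of the secants of the graph of `f`. -/
structure IsSecantGraph (f : K → K) : Prop where
  row_or_secant : ∀ l y, (∃ z, z ≠ y ∧ f z = l) ∨ OnSecant f l y
  secant : ∀ y, OnSecant f (f y) y
  slope : ∀ l, ∃ z w, z ≠ w ∧ f z - f w = l * (z - w)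

lemma OnSecant.sparseComb_two {l y : K} (h : OnSecant f l y) :
    SparseComb K D (graphPoint f) 2 (l, 1, y) := by
  obtain ⟨m, z, w, hzy, hwy, hzw, hz, hw⟩ := h
  exact sparseComb_graphPoint_secant hzw (m := m) (b := l - m * y) (by linear_combination hz)
    (by linear_combination hw) (by simpa using hzy.symm) (by simpa using hwy.symm) (by ring)

lemma OnSecant.sparseComb_three [Fintype K] (hK : 4 ≤ Fintype.card K) {y : K}
    (h : OnSecant f (f y) y) : SparseComb K D (graphPoint f) 3 (f y, 1, y) := by
  obtain ⟨m, z, w, hzy, hwy, hzw, hz, hw⟩ := h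
  exact sparseComb_graphPoint_collinear hK hzy.symm hwy.symm hzw (m := m) (b := f y - m * y)
    (by ring) (by linear_combination hz) (by linear_combination hw) (by ring)

lemma sparseComb_row {l y z : K} (hzy : z ≠ y) (hz : f z = l) :
    SparseComb K D (extendBy (0, 0, 1) (graphPoint f)) 2 (l, 1, y) := by
  refine sparseComb_extendBy_iff.2 (.inr ⟨y - z, sub_ne_zero.2 hzy.symm, 1, rfl, ?_⟩)
  simpa [hz] using sparseComb_graphPoint D f z

lemma sparseComb_slope_three_of_ne {l a a' b c : K} (haa' : a ≠ a')
    (ha : f a' - l * a' = f a - l * a) (hab : f b - l * b ≠ f a - l * a)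
    (hac : f c - l * c ≠ f a - l * a) (hbc : f b - l * b ≠ f c - l * c) :
    SparseComb K D (graphPoint f) 3 (l, 0, 1) := by
  by_cases hdet : (f b - f a) * (c - a) = (f c - f a) * (b - a)
  · have hdet' : (f b - f a') * (c - a') ≠ (f c - f a') * (b - a') := by
      intro h
      refine mul_ne_zero (sub_ne_zero.2 haa') (sub_ne_zero.2 hbc) ?_
      linear_combination h - hdet - (b - c) * ha
    exact sparseComb_graphPoint_noncollinear hdet' (by simpa [ha] using hab.symm)
      (by simpa [ha] using hac.symm) (by simpa using hbc)
  · exact sparseComb_graphPoint_noncollinear hdet (by simpa using hab.symm)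
      (by simpa using hac.symm) (by simpa using hbc)

lemma IsSecantGraph.slope_three [Fintype K] (hK : 5 ≤ Fintype.card K) (hf : IsSecantGraph f)
    (l : K) : SparseComb K D (graphPoint f) 3 (l, 0, 1) := by
  obtain ⟨a, a', haa', hl⟩ := hf.slope l
  have ha : f a' - l * a' = f a - l * a := by linear_combination -hl
  have collinear {x y z : K} (hxy : x ≠ y) (hxz : x ≠ z) (hyz : y ≠ z)
      (hy : f y - l * y = f x - l * x) (hz : f z - l * z = f x - l * x) :
      SparseComb K D (graphPoint f) 3 (l, 0, 1) :=
    sparseComb_graphPoint_collinear (by omega) hxy hxz hyz (m := l) (b := f x - l * x) (by ring)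
      (by linear_combination hy) (by linear_combination hz) (by simp)
  by_cases hthird : ∃ x, x ≠ a ∧ x ≠ a' ∧ f x - l * x = f a - l * a
  · obtain ⟨x, hxa, hxa', hx⟩ := hthird
    exact collinear haa' hxa.symm hxa'.symm ha hx
  push Not at hthird
  obtain ⟨b, hb⟩ := exists_forall_ne_of_card_lt (n := 2) (by omega) ![a, a']
  obtain ⟨c, hc⟩ := exists_forall_ne_of_card_lt (n := 3) (by omega) ![a, a', b]
  obtain ⟨d, hd⟩ := exists_forall_ne_of_card_lt (n := 4) (by omega) ![a, a', b, c]
  have hb' := hthird b (hb 0) (hb 1)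
  by_cases hbc : f b - l * b = f c - l * c
  · by_cases hbd : f b - l * b = f d - l * d
    · exact collinear (hc 2).symm (hd 2).symm (hd 3).symm hbc.symm hbd.symm
    · exact sparseComb_slope_three_of_ne haa' ha hb' (hthird d (hd 0) (hd 1)) hbd
  · exact sparseComb_slope_three_of_ne haa' ha hb' (hthird c (hc 0) (hc 1)) hbc

lemma IsSecantGraph.point (hf : IsSecantGraph f) : SparseComb K D (graphPoint f) 3 (1, 0, 0) := by
  obtain ⟨z, w, hzw, h0⟩ := hf.slope 0
  obtain ⟨u, hu⟩ : ∃ u, f u ≠ f z := by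
    obtain ⟨u, v, huv, h1⟩ := hf.slope 1
    by_contra! h
    exact huv (by simpa [h, sub_eq_zero, eq_comm] using h1)
  have hwz : f w = f z := by simpa [sub_eq_zero, eq_comm] using h0
  have huz : u ≠ z := fun h => hu (h ▸ rfl)
  have huw : u ≠ w := fun h => hu (h ▸ hwz)
  refine sparseComb_graphPoint_noncollinear (x := z) (y := w) (z := u) ?_ ?_ ?_ ?_
  · simpa [hwz, sub_eq_zero] using ⟨hu, hzw.symm⟩
  · simpa using hzw
  · simpa using huz.symm
  · simpa using huw.symm

theorem IsSecantGraph.isGluingCurve [Fintype K] (hK : 5 ≤ Fintype.card K)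
    (hf : IsSecantGraph f) : IsGluingCurve D f where
  affine y l := by
    rcases hf.row_or_secant l y with ⟨z, hzy, hz⟩ | h
    · exact sparseComb_row hzy hz
    · exact h.sparseComb_two.extend _
  slope l _ := by
    obtain ⟨z, w, hzw, hl⟩ := hf.slope l
    exact sparseComb_graphPoint_slope hzw hl
  infinity := by
    obtain ⟨z, w, hzw, hl⟩ := hf.slope 0
    exact (sparseComb_graphPoint_slope hzw hl).extend _
  slope_three := hf.slope_three hK
  point := hf.point
  graph y := (hf.secant y).sparseComb_three (by omega)

end SecantGraph

section RigidSets

variable {K : Type*} [Field K]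

/-- A set that is mapped into itself by no affine bijection of the line other than the identity. -/
def IsAffinelyRigid (T : Finset K) : Prop :=
  ∀ m b : K, m ≠ 0 → (∀ x ∈ T, m * x + b ∈ T) → m = 1 ∧ b = 0

open Classical in
/-- The indicator function of a set, as a function whose graph is to be glued. -/
noncomputable def indicatorGraph (T : Finset K) (x : K) : K := if x ∈ T then 1 else 0

variable {T : Finset K}

lemma exists_indicatorGraph_eq_zero_and_eq_one {m b : K} (hT : IsAffinelyRigid T) (hm : m ≠ 0)
    (hmb : m = 1 → b ≠ 0) :
    ∃ x, indicatorGraph T x = 1 ∧ indicatorGraph T (m * x + b) = 0 := by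
  by_contra! h
  obtain ⟨hm1, hb⟩ := hT m b hm fun x hx => by
    simpa [indicatorGraph] using h x (by simp [indicatorGraph, hx])
  exact hmb hm1 hb

lemma exists_ne_ne_indicatorGraph_eq_one (hT : 3 ≤ T.card) (y : K) :
    ∃ z w, z ≠ y ∧ w ≠ y ∧ z ≠ w ∧ indicatorGraph T z = 1 ∧ indicatorGraph T w = 1 := by
  classical
  have hcard : 1 < (T.erase y).card := by
    have := T.pred_card_le_card_erase (a := y)
    omega
  obtain ⟨z, hz, w, hw, hzw⟩ := Finset.one_lt_card.1 hcard
  rw [Finset.mem_erase] at hz hw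
  exact ⟨z, w, hz.1, hw.1, hzw, by simp [indicatorGraph, hz.2], by simp [indicatorGraph, hw.2]⟩

lemma indicatorGraph_compl [Fintype K] [DecidableEq K] (x : K) :
    indicatorGraph Tᶜ x = 1 - indicatorGraph T x := by
  by_cases hx : x ∈ T <;> simp [indicatorGraph, hx]

lemma exists_ne_ne_indicatorGraph_eq_zero [Fintype K] [DecidableEq K] (hT : 3 ≤ Tᶜ.card) (y : K) :
    ∃ z w, z ≠ y ∧ w ≠ y ∧ z ≠ w ∧ indicatorGraph T z = 0 ∧ indicatorGraph T w = 0 := by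
  simpa [indicatorGraph_compl] using exists_ne_ne_indicatorGraph_eq_one hT y

lemma IsAffinelyRigid.onSecant (hT : IsAffinelyRigid T) {l : K} (hl0 : l ≠ 0) (hl1 : l ≠ 1)
    (y : K) : OnSecant (indicatorGraph T) l y := by
  have h1l : 1 - l ≠ 0 := sub_ne_zero.2 hl1.symm
  obtain ⟨m, hm⟩ : ∃ m, m * (1 - l) = -l := ⟨_, div_mul_cancel₀ _ h1l⟩
  have hm0 : m ≠ 0 := by
    rintro rfl
    exact hl0 (by linear_combination hm)
  have hm1 : m ≠ 1 := by
    rintro rfl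
    exact one_ne_zero (α := K) (by linear_combination hm)
  -- The line through `(l, y)` and `(1, z)` meets the row `0` where `w - y = m * (z - y)`.
  obtain ⟨z, hz, hw⟩ := exists_indicatorGraph_eq_zero_and_eq_one (b := y - m * y) hT hm0
    fun h => absurd h hm1
  have hzy : z ≠ y := by
    rintro rfl
    simp [hz] at hw
  have hzy' : z - y ≠ 0 := sub_ne_zero.2 hzy
  refine ⟨(1 - l) / (z - y), z, m * z + (y - m * y), hzy, ?_, ?_, ?_, ?_⟩
  · intro h
    exact mul_ne_zero hm0 hzy' (by linear_combination h)
  · intro h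
    rw [← h, hz] at hw
    exact one_ne_zero hw
  · rw [hz, div_mul_cancel₀ _ hzy']
  · rw [hw]
    linear_combination -m * div_mul_cancel₀ (1 - l) hzy' - hm

theorem IsAffinelyRigid.isSecantGraph [Fintype K] [DecidableEq K] (hT : IsAffinelyRigid T)
    (hcard : 3 ≤ T.card) (hcompl : 3 ≤ Tᶜ.card) : IsSecantGraph (indicatorGraph T) where
  row_or_secant l y := by
    by_cases hl0 : l = 0
    · obtain ⟨z, -, hzy, -, -, hz, -⟩ := exists_ne_ne_indicatorGraph_eq_zero hcompl y
      exact .inl ⟨z, hzy, hz.trans hl0.symm⟩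
    by_cases hl1 : l = 1
    · obtain ⟨z, -, hzy, -, -, hz, -⟩ := exists_ne_ne_indicatorGraph_eq_one hcard y
      exact .inl ⟨z, hzy, hz.trans hl1.symm⟩
    exact .inr (hT.onSecant hl0 hl1 y)
  secant y := by
    obtain ⟨z, w, hzy, hwy, hzw, hz, hw⟩ : ∃ z w, z ≠ y ∧ w ≠ y ∧ z ≠ w ∧
        indicatorGraph T z = indicatorGraph T y ∧ indicatorGraph T w = indicatorGraph T y := by
      by_cases hy : y ∈ T
      · simpa only [indicatorGraph, if_pos hy] using exists_ne_ne_indicatorGraph_eq_one hcard y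
      · simpa only [indicatorGraph, if_neg hy] using exists_ne_ne_indicatorGraph_eq_zero hcompl y
    exact ⟨0, z, w, hzy, hwy, hzw, by simp [hz], by simp [hw]⟩
  slope l := by
    by_cases hl : l = 0
    · obtain ⟨z, w, -, -, hzw, hz, hw⟩ := exists_ne_ne_indicatorGraph_eq_one hcard 0
      exact ⟨z, w, hzw, by simp [hz, hw, hl]⟩
    · obtain ⟨z, hz, hw⟩ := exists_indicatorGraph_eq_zero_and_eq_one (b := -l⁻¹) hT one_ne_zero
        fun _ => neg_ne_zero.2 (inv_ne_zero hl)
      exact ⟨z, 1 * z + -l⁻¹, by simpa using hl, by rw [hz, hw]; simp [hl]⟩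

open Polynomial in
lemma exists_isAffinelyRigid [Fintype K] (hK : 8 ≤ Fintype.card K) :
    ∃ T : Finset K, IsAffinelyRigid T ∧ T.card = 3 := by
  classical
  -- A transposition of `{0, 1, c}` extends to an affine map only if `c` is `-1`, `2` or `2⁻¹`, and
  -- a 3-cycle only if `c ^ 2 - c + 1 = 0`.
  obtain ⟨c, hc⟩ : ∃ c : K,
      (X * (X - 1) * (X + 1) * (X - 2) * (2 * X - 1) * (X ^ 2 - X + 1) : K[X]).eval c ≠ 0 := by
    refine exists_eval_ne_zero_of_natDegree_lt_card _ ?_ ?_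
    · have hX1 : (X - 1 : K[X]) ≠ 0 := X_sub_C_ne_zero 1
      have hX1' : (X + 1 : K[X]) ≠ 0 := X_add_C_ne_zero 1
      have hX2 : (X - 2 : K[X]) ≠ 0 := X_sub_C_ne_zero 2
      have h2X : (2 * X - 1 : K[X]) ≠ 0 := fun h => by simpa using congrArg (eval 0) h
      have hcyc : (X ^ 2 - X + 1 : K[X]) ≠ 0 := fun h => by simpa using congrArg (eval 0) h
      simp [*]
    · rw [Cardinal.mk_fintype, Nat.cast_lt]
      exact lt_of_le_of_lt (by compute_degree) hK
  simp only [eval_mul, eval_sub, eval_add, eval_pow, eval_X, eval_one, eval_ofNat, ne_eq,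
    mul_eq_zero, not_or] at hc
  obtain ⟨⟨⟨⟨⟨h0, h1⟩, hn1⟩, h2⟩, h2'⟩, hcyc⟩ := hc
  refine ⟨{0, 1, c}, fun m b hm hmb => ?_, ?_⟩
  · simp only [Finset.mem_insert, Finset.mem_singleton, forall_eq_or_imp, forall_eq] at hmb
    obtain ⟨hb0, hb1, hbc⟩ := hmb
    rcases hb0 with hb0 | hb0 | hb0 <;> rcases hb1 with hb1 | hb1 | hb1 <;> grind
  · grind

end RigidSets

section SmallFields

variable {K L : Type*} [Field K] [Field L]

lemma OnSecant.map {f : K → K} {l y : K} (h : OnSecant f l y) (e : K ≃+* L) :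
    OnSecant (e ∘ f ∘ e.symm) (e l) (e y) := by
  obtain ⟨m, z, w, hzy, hwy, hzw, hz, hw⟩ := h
  exact ⟨e m, e z, e w, e.injective.ne hzy, e.injective.ne hwy, e.injective.ne hzw,
    by simpa using congrArg e hz, by simpa using congrArg e hw⟩

lemma IsSecantGraph.map {f : K → K} (hf : IsSecantGraph f) (e : K ≃+* L) :
    IsSecantGraph (e ∘ f ∘ e.symm) where
  row_or_secant l y := by
    obtain ⟨l, rfl⟩ := e.surjective l
    obtain ⟨y, rfl⟩ := e.surjective y
    refine (hf.row_or_secant l y).imp ?_ (·.map e)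
    rintro ⟨z, hzy, hz⟩
    exact ⟨e z, e.injective.ne hzy, by simp [hz]⟩
  secant y := by
    obtain ⟨y, rfl⟩ := e.surjective y
    simpa using (hf.secant y).map e
  slope l := by
    obtain ⟨l, rfl⟩ := e.surjective l
    obtain ⟨z, w, hzw, hl⟩ := hf.slope l
    exact ⟨e z, e w, e.injective.ne hzw, by simpa using congrArg e hl⟩

local instance : Fact (Nat.Prime 5) := ⟨by norm_num⟩

lemma isSecantGraph_zmod_five : IsSecantGraph fun x : ZMod 5 => 2 * x ^ 4 + x ^ 2 + x where
  row_or_secant := by decide +kernel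
  secant := by decide +kernel
  slope := by decide +kernel

local instance : Fact (Nat.Prime 7) := ⟨by norm_num⟩

lemma isSecantGraph_zmod_seven : IsSecantGraph fun x : ZMod 7 => x ^ 3 + x ^ 2 where
  row_or_secant := by decide +kernel
  secant := by decide +kernel
  slope := by decide +kernel

theorem exists_isSecantGraph [Fintype K] (hK : Fintype.card K = 5 ∨ 7 ≤ Fintype.card K) :
    ∃ f : K → K, IsSecantGraph f := by
  classical
  rcases hK with h5 | h7
  · exact ⟨_, isSecantGraph_zmod_five.map (ZMod.ringEquivOfPrime K (by norm_num) h5)⟩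
  obtain h7 | h8 := h7.eq_or_lt
  · exact ⟨_, isSecantGraph_zmod_seven.map (ZMod.ringEquivOfPrime K (by norm_num) h7.symm)⟩
  obtain ⟨T, hT, hcard⟩ := exists_isAffinelyRigid h8
  exact ⟨_, hT.isSecantGraph hcard.ge (by rw [Finset.card_compl]; omega)⟩

theorem isGluingCurve_sq [Fintype K] [CharP K 2] (hK : 3 ≤ Fintype.card K) :
    IsGluingCurve ⊤ fun x : K => x ^ 2 := by
  have slope (l : K) (hl : l ≠ 0) : SparseComb K ⊤ (graphPoint fun x : K => x ^ 2) 2 (l, 0, 1) :=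
    sparseComb_graphPoint_slope hl (w := 0) (by ring)
  obtain ⟨c, hc⟩ := exists_forall_ne_of_card_lt (n := 2) (by omega) ![(0 : K), 1]
  have hc0 : c ≠ 0 := hc 0
  have hc1 : c ≠ 1 := hc 1
  have hc2 : c ^ 2 ≠ 1 := by rwa [← one_pow 2, Ne, CharTwo.sq_inj]
  have hdet : ((1 : K) ^ 2 - 0 ^ 2) * (c - 0) ≠ (c ^ 2 - 0 ^ 2) * (1 - 0) := by
    simpa [pow_two, hc0] using hc1
  refine ⟨fun y l => ?_, slope, ?_, fun l => ?_, ?_, fun y => ?_⟩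
  · obtain ⟨z, rfl⟩ : ∃ z, z ^ 2 = l :=
      Finite.surjective_of_injective CharTwo.sq_injective l
    by_cases hzy : z = y
    · subst hzy
      exact ((sparseComb_graphPoint ⊤ (fun x : K => x ^ 2) z).extend _).mono one_le_two
    · exact sparseComb_row hzy rfl
  · simpa [extendBy] using
      (sparseComb_one ⊤ (extendBy (0, 0, 1) _) none (one_ne_zero (α := K))).mono one_le_two
  · by_cases hl : l = 0
    · subst hl
      exact sparseComb_graphPoint_noncollinear hdet (by simp)
        (by simpa using (pow_ne_zero 2 hc0).symm) (by simpa using hc2.symm)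
    · exact (slope l hl).mono (by norm_num)
  · exact sparseComb_graphPoint_noncollinear hdet (by simp) (by simpa using hc0)
      (by simpa using hc1.symm)
  · exact (sparseComb_graphPoint ⊤ _ y).mono (by norm_num)

lemma exists_isGluingCurve [Fintype K]
    (hK : Fintype.card K = 4 ∨ Fintype.card K = 5 ∨ 7 ≤ Fintype.card K) :
    ∃ f : K → K, IsGluingCurve ⊤ f := by
  obtain h4 | hK := hK
  · have := charP_of_card_eq_prime_pow (p := 2) (f := 2) (R := K) h4
    exact ⟨_, isGluingCurve_sq (by omega)⟩
  · obtain ⟨f, hf⟩ := exists_isSecantGraph hK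
    exact ⟨f, hf.isGluingCurve (by omega)⟩

end SmallFields

section Lifting

variable {K : Type*} [Field K] {ι V W E : Type*} [AddCommGroup V] [Module K V]
  [AddCommGroup W] [Module K W] [Field E] [Algebra K E] [Module E W] [IsScalarTower K E W]

lemma SparseComb.exists_injective {g : ι → V} {k : ℕ} {v : V} (h : SparseComb K ⊥ g k v) :
    ∃ x : Fin k → ι, Function.Injective x ∧ ∃ a : Fin k → K, (∀ j, a j ≠ 0) ∧
      ∑ j, a j • g (x j) = v := by
  obtain ⟨c, rfl, d, hd, hk⟩ := h
  obtain rfl := AddSubmonoid.mem_bot.1 hd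
  let e := c.support.equivFinOfCardEq hk
  refine ⟨fun j => e.symm j, Subtype.val_injective.comp e.symm.injective, fun j => c (e.symm j),
    fun j => Finsupp.mem_support_iff.1 (e.symm j).2, ?_⟩
  rw [e.symm.sum_comp fun i => c i • g i, Finset.sum_coe_sort c.support fun i => c i • g i]
  rfl

/-- The concatenating construction: the members `g i` are extended by all `E`-multiples of the
vectors `u i`. -/
def concatFamily (g : ι → V) (u : ι → W) (p : ι × E) : V × W := (g p.1, p.2 • u p.1)

theorem SparseComb.concat {g : ι → V} {u : ι → W} {k : ℕ} {v : V} (h : SparseComb K ⊥ g k v)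
    (hu : ∀ x : Fin k → ι, Function.Injective x → Submodule.span E (Set.range (u ∘ x)) = ⊤)
    (w : W) : SparseComb K ⊥ (concatFamily (E := E) g u) k (v, w) := by
  obtain ⟨x, hx, a, ha, rfl⟩ := h.exists_injective
  obtain ⟨η, rfl⟩ :=
    (Submodule.mem_span_range_iff_exists_fun E).1 (hu x hx ▸ Submodule.mem_top (x := w))
  have hpair : Function.Injective fun j => (x j, (a j)⁻¹ • η j) :=
    Function.Injective.of_comp (f := Prod.fst) hx
  convert sparseComb_of_injective ⊥ (concatFamily g u) hpair ha <;>
    simp [concatFamily, Prod.fst_sum, Prod.snd_sum, ha]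

/-- Homogeneous coordinates of a point of the projective line over `E`; `none` is the point at
infinity. -/
def projLineCoord (x : Option E) : E × E := x.elim (1, 0) fun y => (y, 1)

lemma projLineCoord_cross_ne_zero {x y : Option E} (h : x ≠ y) :
    (projLineCoord x).1 * (projLineCoord y).2 - (projLineCoord y).1 * (projLineCoord x).2 ≠ 0 := by
  cases x <;> cases y <;> simp_all [projLineCoord, sub_eq_zero]

/-- The rational normal curve in homogeneous coordinates. -/
def rationalNormalCurve (n : ℕ) (x : Option E) : Fin n → E :=
  fun j => (projLineCoord x).1 ^ (j : ℕ) * (projLineCoord x).2 ^ (j.rev : ℕ)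

lemma span_rationalNormalCurve {n : ℕ} {x : Fin n → Option E} (hx : Function.Injective x) :
    Submodule.span E (Set.range (rationalNormalCurve n ∘ x)) = ⊤ := by
  have hdet : (Matrix.projVandermonde (fun i => (projLineCoord (x i)).1)
      fun i => (projLineCoord (x i)).2).det ≠ 0 := by
    rw [Matrix.det_projVandermonde]
    exact Finset.prod_ne_zero_iff.2 fun i _ => Finset.prod_ne_zero_iff.2 fun j hj =>
      projLineCoord_cross_ne_zero (hx.ne (Finset.mem_Ioi.1 hj).ne')
  have hli := Matrix.linearIndependent_rows_of_det_ne_zero hdet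
  exact hli.span_eq_top_of_card_eq_finrank' (by simp)

lemma exists_field_extension (K : Type*) [Field K] [Finite K] {m : ℕ} (hm : m ≠ 0) :
    ∃ (E : Type) (_ : Field E) (_ : Algebra K E) (_ : Fintype E), Module.finrank K E = m := by
  obtain ⟨p, hp⟩ := CharP.exists K
  have : Fact p.Prime := ⟨CharP.char_is_prime K p⟩
  have : NeZero m := ⟨hm⟩
  exact ⟨FiniteField.Extension K p m, inferInstance, inferInstance, Fintype.ofFinite _,
    FiniteField.finrank_extension K p m⟩

theorem exists_concatFamily [Fintype K] [Fintype ι] {g : ι → V} {R : ℕ}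
    (hg : ∀ v, SparseComb K ⊥ g R v) {m : ℕ} (hm : m ≠ 0)
    (hcard : Fintype.card ι ≤ Fintype.card K ^ m + 1) :
    ∃ (E : Type) (_ : Fintype E) (W : Type) (_ : AddCommGroup W) (_ : Module K W)
      (_ : Module.Finite K W) (g' : ι × E → V × W), (∀ v, SparseComb K ⊥ g' R v) ∧
      Fintype.card E = Fintype.card K ^ m ∧ Module.finrank K W = R * m := by
  obtain ⟨E, _, _, _, hE⟩ := exists_field_extension K hm
  have hcardE : Fintype.card E = Fintype.card K ^ m := hE ▸ Module.card_eq_pow_finrank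
  obtain ⟨ν⟩ : Nonempty (ι ↪ Option E) :=
    Function.Embedding.nonempty_of_card_le (by simpa [hcardE] using hcard)
  refine ⟨E, inferInstance, Fin R → E, inferInstance, inferInstance, inferInstance,
    concatFamily g (rationalNormalCurve R ∘ ν), fun ⟨v, w⟩ => ?_, hcardE, ?_⟩
  · refine (hg v).concat (fun x hx => ?_) w
    exact span_rationalNormalCurve (ν.injective.comp hx)
  · simp [Module.finrank_pi_fintype, hE]

end Lifting

section Radius

variable {K : Type*} [Field K] {ι κ V : Type*} [AddCommGroup V] [Module K V]

variable (K) in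
/-- Every vector is a linear combination of at most `ρ` members of the family `h`. -/
def Covers (h : ι → V) (ρ : ℕ) : Prop := ∀ v, SparseComb K ⊤ h ρ v

lemma Covers.mono {h : ι → V} {ρ σ : ℕ} (hh : Covers K h ρ) (hρ : ρ ≤ σ) : Covers K h σ :=
  fun v => (hh v).mono hρ

lemma Covers.span_eq_top {h : ι → V} {ρ : ℕ} (hh : Covers K h ρ) :
    Submodule.span K (Set.range h) = ⊤ := by
  rw [← Finsupp.range_linearCombination, LinearMap.range_eq_top]
  exact fun v => (hh v).imp fun _ hc => hc.1

lemma Covers.comp_equiv {h : ι → V} {ρ : ℕ} (hh : Covers K h ρ) (e : κ ≃ ι) :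
    Covers K (h ∘ e) ρ := fun v =>
  SparseComb.of_comp (x := e.symm) (by simpa [Function.comp_assoc] using hh v) e.symm.injective

lemma linearCombination_update_sub [DecidableEq ι] (h : ι → V) (i : ι) (x : V) (c : ι →₀ K) :
    Finsupp.linearCombination K (Function.update h i (h i - x)) c =
      Finsupp.linearCombination K h c - c i • x := by
  induction c using Finsupp.induction_linear with
  | zero => simp
  | add c d hc hd =>
    rw [map_add, map_add, hc, hd, Finsupp.add_apply, add_smul]
    abel
  | single k a =>
    rcases eq_or_ne k i with rfl | hk
    · simp [smul_sub]
    · simp [hk]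

lemma Covers.update_sub [DecidableEq ι] {h : ι → V} {ρ : ℕ} (hh : Covers K h ρ) {i j : ι}
    (hij : j ≠ i) (a : K) : Covers K (Function.update h i (h i - a • h j)) (ρ + 1) := by
  classical
  intro v
  obtain ⟨c, rfl, hc⟩ := sparseComb_top_iff.1 (hh v)
  refine sparseComb_top_iff.2 ⟨c + Finsupp.single j (c i * a), ?_, ?_⟩
  · rw [linearCombination_update_sub, map_add, Finsupp.linearCombination_single, Finsupp.add_apply,
      Finsupp.single_eq_of_ne hij.symm, add_zero, mul_smul, add_sub_cancel_right]
  · exact (Finset.card_le_card Finsupp.support_add).trans <| (Finset.card_union_le _ _).trans <|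
      add_le_add hc <| (Finset.card_le_card Finsupp.support_single_subset).trans (by simp)

variable {b : Module.Basis κ K V}

lemma Covers.update_sub_basis [DecidableEq ι] {g : ι → V} {ρ : ℕ} (hg : Covers K (Sum.elim b g) ρ)
    (i : ι) (k : κ) (a : K) :
    Covers K (Sum.elim b (Function.update g i (g i - a • b k))) (ρ + 1) := by
  classical
  simpa only [Sum.update_elim_inr, Sum.elim_inl, Sum.elim_inr] using
    hg.update_sub (i := .inr i) (j := .inl k) Sum.inl_ne_inr a

lemma Covers.card_le_of_sumElim_zero [Fintype κ] {ρ : ℕ}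
    (h : Covers K (Sum.elim b (0 : ι → V)) ρ) : Fintype.card κ ≤ ρ := by
  obtain ⟨c, hc, hcard⟩ := sparseComb_top_iff.1 (h (∑ k, b k))
  have hone (k : κ) : c (.inl k) = 1 := by
    have hcoord : b.coord k ∘ₗ Finsupp.linearCombination K (Sum.elim b (0 : ι → V)) =
        Finsupp.lapply (.inl k) := by
      ext (l | i) <;> simp [Finsupp.single_apply_left Sum.inl_injective]
    simpa [hc, Finsupp.single_apply] using (LinearMap.congr_fun hcoord c).symm
  refine le_trans (Finset.card_le_card_of_injOn Sum.inl (s := Finset.univ) ?_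
    Sum.inl_injective.injOn) hcard
  intro k _
  simp [hone k]

lemma repr_sub_repr_smul (v : V) (k : κ) : b.repr (v - b.repr v k • b k) = (b.repr v).erase k := by
  classical
  ext l
  rcases eq_or_ne l k with rfl | hl
  · simp
  · simp [hl]

lemma sum_card_support_repr_update_lt [Fintype ι] [DecidableEq ι] {g : ι → V} {i : ι} {k : κ}
    (hk : b.repr (g i) k ≠ 0) :
    ∑ j, (b.repr (Function.update g i (g i - b.repr (g i) k • b k) j)).support.card <
      ∑ j, (b.repr (g j)).support.card := by
  classical
  refine Finset.sum_lt_sum (fun j _ => ?_) ⟨i, Finset.mem_univ i, ?_⟩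
  · rcases eq_or_ne j i with rfl | hj
    · rw [Function.update_self, repr_sub_repr_smul, Finsupp.support_erase]
      exact Finset.card_erase_le
    · rw [Function.update_of_ne hj]
  · rw [Function.update_self, repr_sub_repr_smul, Finsupp.support_erase]
    exact Finset.card_erase_lt_of_mem (Finsupp.mem_support_iff.2 hk)

theorem Covers.exists_isLeast_sumElim [Finite ι] [Fintype κ] {g : ι → V} {R : ℕ}
    (hg : Covers K (Sum.elim b g) R) (hR : R ≤ Fintype.card κ) :
    ∃ g' : ι → V, IsLeast {ρ | Covers K (Sum.elim b g') ρ} R := by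
  classical
  have := Fintype.ofFinite ι
  obtain ⟨g', hg', hmin⟩ := exists_minimalFor_of_wellFoundedLT
    (fun g' : ι → V => Covers K (Sum.elim b g') R)
    (fun g' => ∑ i, (b.repr (g' i)).support.card) ⟨g, hg⟩
  refine ⟨g', hg', fun ρ hρ => ?_⟩
  by_contra! hlt
  have hne : g' ≠ 0 := by
    rintro rfl
    exact (hlt.trans_le hR).not_ge hρ.card_le_of_sumElim_zero
  obtain ⟨i, hi⟩ := Function.ne_iff.1 hne
  obtain ⟨k, hk⟩ := Finsupp.ne_iff.1 (b.repr.map_ne_zero_iff.2 hi)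
  have hdec := sum_card_support_repr_update_lt hk
  exact hdec.not_ge (hmin ((hρ.update_sub_basis i k _).mono hlt) hdec.le)

theorem Covers.exists_isLeast [Finite ι] [Module.Finite K V] {h : ι → V} {R : ℕ}
    (hh : Covers K h R) (hR : R ≤ Module.finrank K V) :
    ∃ h' : ι → V, IsLeast {ρ | Covers K h' ρ} R := by
  classical
  obtain ⟨κ, e, he, hspan, hli⟩ := exists_linearIndependent' K h
  let b : Module.Basis κ K V := .mk hli (by rw [hspan, hh.span_eq_top])
  have : Fintype κ := FiniteDimensional.fintypeBasisIndex b
  let e' : κ ⊕ ↥(Set.range e)ᶜ ≃ ι :=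
    ((Equiv.ofInjective e he).sumCongr (.refl _)).trans (Equiv.Set.sumCompl _)
  have hb : h ∘ e' = Sum.elim b fun i : ↥(Set.range e)ᶜ => h i := by
    ext (k | i) <;> simp [e', b]
  obtain ⟨g, hg, hmin⟩ := (hb ▸ hh.comp_equiv e').exists_isLeast_sumElim
    (hR.trans_eq (Module.finrank_eq_card_basis b))
  refine ⟨Sum.elim b g ∘ e'.symm, hg.comp_equiv _, fun ρ hρ => hmin ?_⟩
  simpa [Function.comp_assoc] using Covers.comp_equiv hρ e'

end Radius

section Transfer

variable {K : Type*} [Field K] {ι κ V W : Type*} [AddCommGroup V] [Module K V]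
  [AddCommGroup W] [Module K W] {h : ι → V} {ρ : ℕ}

lemma Covers.map (hh : Covers K h ρ) (e : V ≃ₗ[K] W) : Covers K (e ∘ h) ρ := fun w => by
  simpa using (hh (e.symm w)).map (e : V →ₗ[K] W)

lemma covers_map_iff (e : V ≃ₗ[K] W) : Covers K (e ∘ h) ρ ↔ Covers K h ρ := by
  refine ⟨fun hh => ?_, fun hh => hh.map e⟩
  simpa [Function.comp_def] using hh.map e.symm

lemma covers_comp_equiv_iff (e : κ ≃ ι) : Covers K (h ∘ e) ρ ↔ Covers K h ρ := by
  refine ⟨fun hh => ?_, fun hh => hh.comp_equiv e⟩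
  simpa [Function.comp_assoc] using hh.comp_equiv e.symm

lemma Covers.surjective [Fintype ι] (hh : Covers K h ρ) :
    Function.Surjective (Fintype.linearCombination K h) := by
  rw [← LinearMap.range_eq_top, Fintype.range_linearCombination, hh.span_eq_top]

lemma not_covers_zero [Nontrivial V] : ¬ Covers K h 0 := by
  intro hh
  obtain ⟨v, hv⟩ := exists_ne (0 : V)
  obtain ⟨c, rfl, hc⟩ := sparseComb_top_iff.1 (hh v)
  obtain rfl : c = 0 := by simpa using hc
  exact hv (map_zero _)

lemma SparseComb.trans {g : κ → V} {k l : ℕ} {v : V} (hv : SparseComb K ⊤ h k v)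
    (hg : ∀ i, SparseComb K ⊤ g l (h i)) : SparseComb K ⊤ g (k * l) v := by
  classical
  simp only [sparseComb_top_iff_mem_span] at *
  choose S hS hmem using hg
  obtain ⟨T, hT, hv⟩ := hv
  refine ⟨T.biUnion S, (Finset.card_biUnion_le_card_mul _ _ _ fun i _ => hS i).trans
    (Nat.mul_le_mul_right l hT), Submodule.span_le.2 ?_ hv⟩
  rintro _ ⟨i, hi, rfl⟩
  exact Submodule.span_mono
    (Set.image_mono (Finset.coe_subset.2 (Finset.subset_biUnion_of_mem S hi))) (hmem i)

end Transfer

section Codes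

variable {K : Type*} [Field K] [DecidableEq K] {V : Type*} [AddCommGroup V] [Module K V] {n : ℕ}

lemma coversWithRadius_ker_iff {h : Fin n → V} {ρ : ℕ}
    (hs : Function.Surjective (Fintype.linearCombination K h)) :
    CoversWithRadius (LinearMap.ker (Fintype.linearCombination K h)) ρ ↔ Covers K h ρ := by
  rw [Covers, hs.forall]
  refine forall_congr' fun x => ?_
  rw [sparseComb_top_iff_hammingNorm]
  constructor
  · rintro ⟨c, hc, hd⟩
    exact ⟨x - c, by rw [map_sub, LinearMap.mem_ker.1 hc, sub_zero],
      by rwa [← neg_add_eq_sub, ← hammingDist_eq_hammingNorm, hammingDist_comm]⟩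
  · rintro ⟨y, hy, hn⟩
    exact ⟨x - y, by rw [LinearMap.mem_ker, map_sub, hy, sub_self],
      by rwa [hammingDist_comm, hammingDist_eq_hammingNorm, neg_add_eq_sub, sub_sub_cancel]⟩

lemma lengthFunction_le_of_isLeast [Module.Finite K V] {ι : Type*} [Fintype ι] {h : ι → V} {R : ℕ}
    (hh : IsLeast {ρ | Covers K h ρ} R) :
    lengthFunction K (Module.finrank K V) R ≤ Fintype.card ι := by
  let e := (Fintype.equivFin ι).symm
  have hs : Function.Surjective (Fintype.linearCombination K (h ∘ e)) :=
    (hh.1.comp_equiv e).surjective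
  refine iInf₂_le _ ⟨LinearMap.ker (Fintype.linearCombination K (h ∘ e)), ?_, ?_⟩
  · have := LinearMap.finrank_range_add_finrank_ker (Fintype.linearCombination K (h ∘ e))
    rwa [LinearMap.range_eq_top.2 hs, finrank_top, Module.finrank_fin_fun, add_comm] at this
  · simpa only [coversWithRadius_ker_iff hs, covers_comp_equiv_iff] using hh

theorem lengthFunction_le_of_covers [Module.Finite K V] {ι : Type*} [Fintype ι] {h : ι → V} {R : ℕ}
    (hh : Covers K h R) (hR : R ≤ Module.finrank K V) :
    lengthFunction K (Module.finrank K V) R ≤ Fintype.card ι := by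
  obtain ⟨h', hh'⟩ := hh.exists_isLeast hR
  exact lengthFunction_le_of_isLeast hh'

lemma IsCoveringCode.exists_isLeast_covers {C : Submodule K (Fin n → K)} {r R : ℕ}
    (hC : IsCoveringCode C r R) :
    ∃ h : Fin n → (Fin n → K) ⧸ C, Module.finrank K ((Fin n → K) ⧸ C) = r ∧
      IsLeast {ρ | Covers K h ρ} R := by
  let h : Fin n → (Fin n → K) ⧸ C := fun i => C.mkQ (Pi.single i 1)
  have hmkQ : Fintype.linearCombination K h = C.mkQ := by
    ext i
    simp [h, Fintype.linearCombination_apply_single]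
  have hs : Function.Surjective (Fintype.linearCombination K h) := hmkQ ▸ C.mkQ_surjective
  refine ⟨h, ?_, ?_⟩
  · have hquot := C.finrank_quotient_add_finrank
    rw [Module.finrank_fin_fun] at hquot
    have := hC.1
    omega
  · simpa only [← coversWithRadius_ker_iff hs, hmkQ, Submodule.ker_mkQ] using hC.2

end Codes

section Saturating

variable {K : Type*} [Field K] {N : ℕ}

lemma iSup_submodule_eq_span {S : Finset (PG N K)} (T : Finset S) :
    ⨆ P ∈ T.map (.subtype (· ∈ S)), P.submodule =
      Submodule.span K ((fun P : S => P.1.rep) '' T) := by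
  rw [Submodule.span_eq_iSup_of_singleton_spans, iSup_image, ← Finset.sup_eq_iSup, Finset.sup_map,
    Finset.sup_eq_iSup]
  exact iSup_congr fun P => iSup_congr fun _ => P.1.submodule_eq

lemma saturatesWith_iff_covers_rep {S : Finset (PG N K)} {ρ : ℕ} :
    SaturatesWith S ρ ↔ Covers K (fun P : S => P.1.rep) (ρ + 1) := by
  classical
  simp only [SaturatesWith, Covers, sparseComb_top_iff_mem_span]
  constructor
  · intro hS v
    by_cases hv : v = 0
    · exact ⟨∅, by simp, hv ▸ Submodule.zero_mem _⟩
    obtain ⟨T, hTS, hT, hle⟩ := hS (.mk K v hv)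
    obtain ⟨T, rfl⟩ : ∃ T' : Finset S, T'.map (.subtype _) = T :=
      ⟨T.subtype (· ∈ S), Finset.subtype_map_of_mem hTS⟩
    rw [iSup_submodule_eq_span, Projectivization.submodule_mk,
      Submodule.span_singleton_le_iff_mem] at hle
    exact ⟨T, by rwa [Finset.card_map] at hT, hle⟩
  · intro hS A
    obtain ⟨T, hT, hA⟩ := hS A.rep
    refine ⟨T.map (.subtype _), Finset.map_subtype_subset T, by rwa [Finset.card_map], ?_⟩
    rwa [iSup_submodule_eq_span, A.submodule_eq, Submodule.span_singleton_le_iff_mem]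

lemma isSaturating_iff_isLeast_covers_rep {S : Finset (PG N K)} {ρ : ℕ} :
    IsSaturating S ρ ↔ IsLeast {σ | Covers K (fun P : S => P.1.rep) σ} (ρ + 1) := by
  simp only [IsSaturating, saturatesWith_iff_covers_rep]
  refine and_congr_right fun _ => ⟨fun hmin => ?_,
    fun hmin σ hσ => Nat.succ_le_succ_iff.1 (hmin hσ)⟩
  rintro (_ | σ) hσ
  · exact absurd hσ not_covers_zero
  · exact Nat.succ_le_succ (hmin hσ)

variable {ι : Type*} [Fintype ι]

open Classical in
/-- The set of points of `PG(N, K)` represented by the nonzero members of a family of vectors; it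
turns a covering family into a saturating set. -/
noncomputable def pointSet (h : ι → Fin (N + 1) → K) : Finset (PG N K) :=
  Finset.univ.image fun i : {i // h i ≠ 0} => Projectivization.mk K (h i) i.2

lemma mem_pointSet {h : ι → Fin (N + 1) → K} {P : PG N K} :
    P ∈ pointSet h ↔ ∃ i, ∃ hi : h i ≠ 0, Projectivization.mk K (h i) hi = P := by
  simp [pointSet]

lemma card_pointSet_le (h : ι → Fin (N + 1) → K) : (pointSet h).card ≤ Fintype.card ι := by
  classical
  exact Finset.card_image_le.trans (Fintype.card_subtype_le _)

lemma covers_rep_pointSet_iff {h : ι → Fin (N + 1) → K} {ρ : ℕ} :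
    Covers K (fun P : pointSet h => P.1.rep) ρ ↔ Covers K h ρ := by
  constructor
  · refine fun hrep v => mul_one ρ ▸ (hrep v).trans fun ⟨P, hP⟩ => ?_
    obtain ⟨i, hi, rfl⟩ := mem_pointSet.1 hP
    obtain ⟨a, ha⟩ := Projectivization.exists_smul_eq_mk_rep K (h i) hi
    exact ha.symm ▸ sparseComb_one ⊤ h i a.ne_zero
  · refine fun hh v => mul_one ρ ▸ (hh v).trans fun i => ?_
    by_cases hi : h i = 0
    · exact hi ▸ (sparseComb_zero ⊤ _).mono zero_le_one
    · obtain ⟨a, ha⟩ := Projectivization.exists_smul_eq_mk_rep K (h i) hi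
      let P : pointSet h := ⟨_, mem_pointSet.2 ⟨i, hi, rfl⟩⟩
      rw [← inv_smul_eq_iff.2 ha.symm]
      exact sparseComb_one ⊤ _ P a⁻¹.ne_zero

lemma smallestSaturatingSize_le_of_isLeast {V : Type*} [AddCommGroup V] [Module K V]
    [Module.Finite K V] {h : ι → V} {ρ : ℕ} (hV : Module.finrank K V = N + 1)
    (hh : IsLeast {σ | Covers K h σ} (ρ + 1)) :
    smallestSaturatingSize K N ρ ≤ Fintype.card ι := by
  let e : V ≃ₗ[K] (Fin (N + 1) → K) := LinearEquiv.ofFinrankEq _ _ (by simpa using hV)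
  refine (iInf₂_le (pointSet (e ∘ h)) ?_).trans (by exact_mod_cast card_pointSet_le _)
  simpa only [isSaturating_iff_isLeast_covers_rep, covers_rep_pointSet_iff, covers_map_iff] using hh

theorem lengthFunction_eq_smallestSaturatingSize (K : Type*) [Field K] [DecidableEq K] {r R : ℕ}
    (hr : 1 ≤ r) (hR : 1 ≤ R) :
    lengthFunction K r R = smallestSaturatingSize K (r - 1) (R - 1) := by
  obtain ⟨N, rfl⟩ := Nat.exists_eq_add_of_le' hr
  obtain ⟨ρ, rfl⟩ := Nat.exists_eq_add_of_le' hR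
  refine le_antisymm (le_iInf₂ fun S hS => ?_) (le_iInf₂ fun n ⟨C, hC⟩ => ?_)
  · simpa using lengthFunction_le_of_isLeast (isSaturating_iff_isLeast_covers_rep.1 hS)
  · obtain ⟨h, hr, hh⟩ := hC.exists_isLeast_covers
    simpa using smallestSaturatingSize_le_of_isLeast hr hh

end Saturating

section Bounds

variable {K : Type*} [Field K] [Fintype K] [DecidableEq K]

theorem lengthFunction_two_mul_le {D : AddSubmonoid ℕ} {f : K → K} (hf : IsGluingCurve D f)
    (hK : 4 ≤ Fintype.card K) {R : ℕ} (hR : 1 ≤ R) :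
    lengthFunction K (2 * R) R ≤ (R * Fintype.card K + 1 : ℕ) := by
  obtain ⟨V, _, _, _, ι, _, g, P, hg, hV, hι⟩ := hf.exists_isGlueable hK hR
  have hcov : Covers K (extendBy P g) R := by
    intro v
    by_cases hv : v = 0
    · exact hv ▸ (sparseComb_zero ⊤ _).mono R.zero_le
    · exact (hg.spans v fun h => absurd h hv).to_top
  simpa only [hV, hι, Fintype.card_option] using
    lengthFunction_le_of_covers hcov (by omega)

theorem lengthFunction_add_two_mul_le {f : K → K} (hf : IsGluingCurve ⊥ f)
    (hK : 4 ≤ Fintype.card K) {R : ℕ} (hR : 3 ≤ R) {m : ℕ} (hm : m ≠ 0)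
    (hRm : R * Fintype.card K ≤ Fintype.card K ^ m) :
    lengthFunction K ((m + 2) * R) R ≤
      ((R * Fintype.card K + 1) * Fintype.card K ^ m : ℕ) := by
  obtain ⟨V, _, _, _, ι, _, g, P, hg, hV, hι⟩ := hf.exists_isGlueable hK (show 1 ≤ R by omega)
  obtain ⟨E, _, W, _, _, _, g', hg', hE, hW⟩ :=
    exists_concatFamily (fun v => hg.spans v fun _ => hR) hm
      (by rw [Fintype.card_option, hι]; omega)
  have hVW : Module.finrank K (V × W) = (m + 2) * R := by
    rw [Module.finrank_prod, hV, hW]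
    ring
  have hcov : Covers K g' R := fun v => (hg' v).to_top
  simpa only [hVW, Fintype.card_prod, Fintype.card_option, hι, hE] using
    lengthFunction_le_of_covers hcov (by rw [hVW]; nlinarith)

end Bounds

lemma le_pow_of_ceil_logb_le {q a n : ℕ} (hq : 2 ≤ q) (ha : 0 < a)
    (h : ⌈Real.logb q a⌉₊ ≤ n) : a ≤ q ^ n := by
  have hlog : Real.logb q a ≤ n := Nat.ceil_le.1 h
  rw [Real.logb_le_iff_le_rpow (by exact_mod_cast hq) (by exact_mod_cast ha),
    Real.rpow_natCast] at hlog
  exact_mod_cast hlog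

lemma ceil_logb_add_one_le_mOne {q R : ℕ} (hq : 2 ≤ q) (hR : 1 ≤ R) :
    ⌈Real.logb q R⌉₊ + 1 ≤ mOne q R := by
  have : Real.logb q R ≤ Real.logb q (R + 1) :=
    Real.logb_le_logb_of_le (by exact_mod_cast hq) (by exact_mod_cast hR) (by linarith)
  exact Nat.succ_le_succ (Nat.ceil_le_ceil this)

lemma lengthBound_add_three (q m R : ℕ) :
    lengthBound q (m + 3) R 0 = (R * q + 1) * q ^ (m + 1) := by
  simp only [lengthBound, show m + 3 - 1 = m + 2 by omega,
    show m + 3 - 2 = m + 1 by omega]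
  ring

lemma lengthBound_mono {q t R Δ Δ' : ℕ} (h : Δ ≤ Δ') : lengthBound q t R Δ ≤ lengthBound q t R Δ' :=
  Nat.add_le_add_left h _

theorem mainTheorem8_general {K : Type*} [Field K] [Fintype K] [DecidableEq K] {q : ℕ}
    (hq : Fintype.card K = q) {t R : ℕ} (ht : 2 ≤ t) (hR : 1 ≤ R) :
    lengthFunction K (t * R) R = smallestSaturatingSize K (t * R - 1) (R - 1) ∧
    (t = 2 → (q = 4 ∨ q = 5 ∨ 7 ≤ q) → lengthFunction K (t * R) R ≤ lengthBound q t R 0) ∧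
    (3 ≤ R → ⌈Real.logb q R⌉₊ + 3 ≤ t → (q = 5 ∨ 7 ≤ q) →
      lengthFunction K (t * R) R ≤ lengthBound q t R 0) := by
  refine ⟨lengthFunction_eq_smallestSaturatingSize K (by nlinarith) hR, ?_, ?_⟩
  · rintro rfl h
    subst hq
    obtain ⟨f, hf⟩ := exists_isGluingCurve h
    simpa [lengthBound] using lengthFunction_two_mul_le hf (by omega) hR
  · intro hR3 hRt h
    subst hq
    obtain ⟨f, hf⟩ := exists_isSecantGraph h
    obtain ⟨m, rfl⟩ := Nat.exists_eq_add_of_le' (show 3 ≤ t by omega)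
    have hRm : R ≤ Fintype.card K ^ m := le_pow_of_ceil_logb_le (by omega) hR (by omega)
    rw [lengthBound_add_three]
    exact lengthFunction_add_two_mul_le (hf.isGluingCurve (by omega)) (by omega) hR3 m.succ_ne_zero
      (by rw [pow_succ]; exact Nat.mul_le_mul_right _ hRm)

theorem mainTheorem8 {K : Type*} [Field K] [Fintype K] [DecidableEq K] (q : ℕ)
    (hq : Fintype.card K = q) (t R : ℕ) (ht : 2 ≤ t) (hR : 4 ≤ R) :
    lengthFunction K (t * R) R = smallestSaturatingSize K (t * R - 1) (R - 1) ∧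
    (t = 2 → (q = 4 ∨ 7 ≤ q) →
      lengthFunction K (t * R) R ≤ (lengthBound q t R 0 : ℕ∞)) ∧
    (t = 2 → q = 5 → (R = 4 ∨ R = 5) →
      lengthFunction K (t * R) R ≤ (lengthBound q t R 0 : ℕ∞)) ∧
    (⌈Real.logb (q : ℝ) (R : ℝ)⌉₊ + 3 ≤ t → 7 ≤ q → Odd q →
      lengthFunction K (t * R) R ≤ (lengthBound q t R 0 : ℕ∞)) ∧
    (mOne q R + 2 < t → t < 3 * mOne q R + 2 → 8 ≤ q → Even q →
      lengthFunction K (t * R) R ≤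
        (lengthBound q t R (∑ j ∈ Finset.Icc 2 t, q ^ (t - j)) : ℕ∞)) ∧
    ((t = mOne q R + 2 ∨ 3 * mOne q R + 2 ≤ t) → 8 ≤ q → Even q →
      lengthFunction K (t * R) R ≤
        (lengthBound q t R (∑ j ∈ Finset.Icc 2 (mOne q R + 2), q ^ (t - j)) : ℕ∞)) := by
  obtain ⟨heq, htwo, hlift⟩ := mainTheorem8_general hq ht (R := R) (by omega)
  have hlift_mOne (hmt : mOne q R + 2 ≤ t) (h8 : 8 ≤ q) (Δ : ℕ) :
      lengthFunction K (t * R) R ≤ lengthBound q t R Δ := by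
    have hceil := ceil_logb_add_one_le_mOne (q := q) (R := R) (by omega) (by omega)
    exact (hlift (by omega) (by omega) (by omega)).trans
      (by exact_mod_cast lengthBound_mono Δ.zero_le)
  exact ⟨heq, fun h hq => htwo h (by omega), fun h hq _ => htwo h (by omega),
    fun h hq _ => hlift (by omega) h (by omega), fun h _ h8 _ => hlift_mOne (by omega) h8 _,
    fun h h8 _ => hlift_mOne (by omega) h8 _⟩
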